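/- Let $x[t+1]=Ax[t]+Bu[t]+w[t]$, $t\ge 0$, with $x[t]\in\mathbb{R}^n$, $u[t]\in\mathbb{R}^m$ and unknown $A,B$. Let $(\mathcal F_t)_{t\ge0}$ be a filtration such that $x[0]$ is $\mathcal F_0$-measurable, and for every $t$ the input $u[t]$ is $\mathcal F_t$-measurable, $w[t]$ is $\mathcal F_{t+1}$-measurable, independent of $\mathcal F_t$ and Gaussian with mean $0$ and positive semidefinite covariance $W$ (so the $w[t]$ are i.i.d. and the control is causal). Assume $W\preceq rI$ and $\|[A\ B]\|_F\le s$ with known $r,s>0$. Let $\lambda>0$, $\delta\in(0,1]$, let $\mathcal U\subseteq\mathbb{R}^m$ be bounded, and let the safe set at time $t$ be $\{x: H[t]x\le h[t]\}$ (entrywise), for given matrices $H[t]$ and vectors $h[t]$. For $k\ge0$ let $Z[k]$ be the matrix with rows $(x[t]^\top,u[t]^\top)$, $0\le t\le k-1$, let $X_i[k]=(x_i[1],\dots,x_i[k])^\top$, $V[k]=Z[k]^\top Z[k]+\lambda I$, $\hat\theta_i[k]=V[k]^{-1}Z[k]^\top X_i[k]$, and let $[\hat A[k]\ \hat B[k]]$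 be the matrix with rows $\hat\theta_1[k]^\top,\dots,\hat\theta_n[k]^\top$. Put $$\beta_k(\eta)=\sqrt{r}\,\sqrt{2\log\frac{\det(V[k])^{1/2}}{\lambda^{(n+m)/2}\,\eta}}+\lambda^{1/2}s,\qquad \zeta_k=\sup_{u\in\mathcal U}\left\|V[k]^{-1/2}\begin{bmatrix}x[k]\\u\end{bmatrix}\right\|_2 .$$ Given a distance function $\mathbf d$ on $\mathbb{R}^m$ and a nominal input $\bar u[k]$, the robust safety-filter problem at time $k$ is to minimize $\mathbf d(u,\bar u[k])$ over all $u\in\mathcal U$ such that $H[k+1](\hat A[k]x[k]+\hat B[k]u+v+w)\le h[k+1]$ for all $w\in\mathbb{R}^n$ with $w^\top w\le 2rn/\delta$ and all $v\in\mathbb{R}^n$ with $v^\top v\le\zeta_k^2n^2\beta_k^2(\delta/(2n))$. It is feasible if some $u$ satisfies these constraints; feasibility depends on the random data $x[0],\dots,x[k],u[0],\dots,u[k-1]$. Theorem. Fix $k$, and suppose that almost surely, whenever the problem at time $k$ is feasible, the applied input $u[k]$ is a solution of it. Then the probability that the problem is feasible at time $k$ and yet $H[k+1]x[k+1]\le h[k+1]$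 fails is at most $\delta$. In particular, if the problem is feasible at time $k$ almost surely, then $$\mathbb{P}\{H[k+1]x[k+1]\le h[k+1]\}\ge 1-\delta .$$ -/

import Mathlib

open MeasureTheory ProbabilityTheory Matrix
open scoped MatrixOrder

namespace SafeLearning

noncomputable section

variable {n m : ℕ}

/-- The Frobenius norm of a real matrix. -/
def frobeniusNorm {ι κ : Type*} [Fintype ι] [Fintype κ] (M : Matrix ι κ ℝ) : ℝ :=
  √(∑ i, ∑ j, M i j ^ 2)

/-- The Euclidean norm of a plain vector. -/
def euclNorm {ι : Type*} [Fintype ι] (a : ι → ℝ) : ℝ := ‖WithLp.toLp 2 a‖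

/-- The regressor matrix `Z[k]`: its rows are `(x[t]ᵀ, u[t]ᵀ)` for `t = 0, …, k - 1`. -/
def dataMatrix (x : ℕ → Fin n → ℝ) (u : ℕ → Fin m → ℝ) (k : ℕ) :
    Matrix (Fin k) (Fin n ⊕ Fin m) ℝ :=
  Matrix.of fun t => Sum.elim (x t) (u t)

/-- The vector `X_i[k] = (x_i[1], …, x_i[k])`. -/
def outputVec (x : ℕ → Fin n → ℝ) (k : ℕ) (i : Fin n) : Fin k → ℝ :=
  fun t => x (t + 1) i

/-- `V[k] = Z[k]ᵀ Z[k] + lam I`. -/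
def gram (lam : ℝ) (x : ℕ → Fin n → ℝ) (u : ℕ → Fin m → ℝ) (k : ℕ) :
    Matrix (Fin n ⊕ Fin m) (Fin n ⊕ Fin m) ℝ :=
  (dataMatrix x u k)ᵀ * dataMatrix x u k + lam • 1

/-- The regularized least-squares estimate of the `i`-th row `θ_i` of `[A B]`. -/
def thetaHat (lam : ℝ) (x : ℕ → Fin n → ℝ) (u : ℕ → Fin m → ℝ) (k : ℕ) (i : Fin n) :
    Fin n ⊕ Fin m → ℝ :=
  (gram lam x u k)⁻¹ *ᵥ ((dataMatrix x u k)ᵀ *ᵥ outputVec x k i)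

/-- The learned state matrix `Â[k]`. -/
def Ahat (lam : ℝ) (x : ℕ → Fin n → ℝ) (u : ℕ → Fin m → ℝ) (k : ℕ) :
    Matrix (Fin n) (Fin n) ℝ :=
  Matrix.of fun i j => thetaHat lam x u k i (Sum.inl j)

/-- The learned input matrix `B̂[k]`. -/
def Bhat (lam : ℝ) (x : ℕ → Fin n → ℝ) (u : ℕ → Fin m → ℝ) (k : ℕ) :
    Matrix (Fin n) (Fin m) ℝ :=
  Matrix.of fun i j => thetaHat lam x u k i (Sum.inr j)

/-- The confidence radius `β_k(δ)`, where `r` bounds the noise variance (so that `√r` is the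
sub-Gaussian parameter) and `s` bounds the model parameters. -/
def confRadius (r s lam : ℝ) (x : ℕ → Fin n → ℝ) (u : ℕ → Fin m → ℝ) (k : ℕ) (δ : ℝ) : ℝ :=
  √r * √(2 * Real.log (√(gram lam x u k).det / (lam ^ (((n + m : ℕ) : ℝ) / 2) * δ)))
    + √lam * s

/-- `ζ_k`, the maximum (supremum) over `u ∈ U` of `‖V[k]^{-1/2} (x[k], u)‖₂`. -/
def zeta (lam : ℝ) (U : Set (Fin m → ℝ)) (x : ℕ → Fin n → ℝ) (u : ℕ → Fin m → ℝ)
    (k : ℕ) : ℝ :=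
  sSup ((fun u' => euclNorm ((CFC.sqrt (gram lam x u k))⁻¹ *ᵥ Sum.elim (x k) u')) '' U)

/-- The input `u'` satisfies the constraints of the robust safety filter at time `k`, given the
data `x[0], …, x[k]`, `u[0], …, u[k-1]` and the safe set `{ξ | H ξ ≤ h}` of time `k + 1`. -/
def Admissible (r s lam δ : ℝ) (U : Set (Fin m → ℝ)) {p : ℕ}
    (H : Matrix (Fin p) (Fin n) ℝ) (h : Fin p → ℝ)
    (x : ℕ → Fin n → ℝ) (u : ℕ → Fin m → ℝ) (k : ℕ) (u' : Fin m → ℝ) : Prop :=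
  u' ∈ U ∧
    ∀ w : Fin n → ℝ, w ⬝ᵥ w ≤ 2 * r * n / δ →
    ∀ v : Fin n → ℝ,
      v ⬝ᵥ v ≤ zeta lam U x u k ^ 2 * (n : ℝ) ^ 2 * confRadius r s lam x u k (δ / (2 * n)) ^ 2 →
      H *ᵥ (Ahat lam x u k *ᵥ x k + Bhat lam x u k *ᵥ u' + v + w) ≤ h

/-- The robust safety-filter problem at time `k` is feasible. -/
def Feasible (r s lam δ : ℝ) (U : Set (Fin m → ℝ)) {p : ℕ}
    (H : Matrix (Fin p) (Fin n) ℝ) (h : Fin p → ℝ)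
    (x : ℕ → Fin n → ℝ) (u : ℕ → Fin m → ℝ) (k : ℕ) : Prop :=
  ∃ u', Admissible r s lam δ U H h x u k u'

/-- `u'` solves the robust safety-filter problem at time `k`: it minimizes the distance `d` to the
nominal input `ubar` among all inputs that satisfy the constraints. -/
def IsSolution (r s lam δ : ℝ) (U : Set (Fin m → ℝ)) {p : ℕ}
    (H : Matrix (Fin p) (Fin n) ℝ) (h : Fin p → ℝ)
    (d : (Fin m → ℝ) → (Fin m → ℝ) → ℝ) (ubar : Fin m → ℝ)
    (x : ℕ → Fin n → ℝ) (u : ℕ → Fin m → ℝ) (k : ℕ) (u' : Fin m → ℝ) : Prop :=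
  Admissible r s lam δ U H h x u k u' ∧
    ∀ u'', Admissible r s lam δ U H h x u k u'' → d u' ubar ≤ d u'' ubar

end

end SafeLearning

/-! The next state is the predicted state plus `v + w k`, where `v` is the error of the learned
model at the applied input. The filter enforces the constraint for all `v` and `w` in two balls, so
safety can fail only if the noise or the model error leaves its ball (`safe_of_admissible`). Each of
these events gets probability `δ / 2`.

The noise has second moment at most `n r`, so Markov's inequality suffices
(`measure_lt_dotProduct_self_le`). For the model, the normal equations write each row error as `V⁻¹
(lam θ - Zᵀ e)`, and Cauchy-Schwarz after splitting `V⁻¹` between both factors bounds it by `ζ β`,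
provided `‖V^{-1/2} Zᵀ e‖` is small (`abs_ridge_error_dotProduct_le`). A union bound gives each of
the `n` rows the level `δ / (2 n)`, with no independence between coordinates.

That last norm is controlled by the method of mixtures (`measure_selfNormalized_le`). With `S = Zᵀ
e`, the variable `exp (a ⬝ S - r ‖Z a‖² / 2)` has mean at most one for each fixed `a`. Integrating
over `a` with a Gaussian weight and completing the square turns it into `exp (‖V^{-1/2} S‖² / (2
r))` divided by a multiple of `√det V`; Markov's inequality then yields the radius. Since `k` is
fixed, no stopping argument is needed. -/

namespace SafeLearning

/-! ### Euclidean norm of plain vectors -/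

section Norm

variable {ι : Type*} [Fintype ι]

lemma euclNorm_nonneg (a : ι → ℝ) : 0 ≤ euclNorm a := norm_nonneg _

lemma euclNorm_sq (a : ι → ℝ) : euclNorm a ^ 2 = a ⬝ᵥ a := by
  rw [euclNorm, EuclideanSpace.real_norm_sq_eq, dotProduct]
  exact Finset.sum_congr rfl fun _ _ => sq _

lemma abs_dotProduct_le (a b : ι → ℝ) : |a ⬝ᵥ b| ≤ euclNorm a * euclNorm b := by
  have h := abs_real_inner_le_norm (WithLp.toLp 2 b) (WithLp.toLp 2 a)
  rw [EuclideanSpace.inner_toLp_toLp] at h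
  simpa [euclNorm, mul_comm] using h

lemma euclNorm_sub_le (a b : ι → ℝ) : euclNorm (a - b) ≤ euclNorm a + euclNorm b := by
  simpa [euclNorm] using norm_sub_le (WithLp.toLp 2 a) (WithLp.toLp 2 b)

lemma euclNorm_smul (c : ℝ) (a : ι → ℝ) : euclNorm (c • a) = |c| * euclNorm a := by
  simp [euclNorm, norm_smul]

lemma dotProduct_sub_self (a b : ι → ℝ) :
    (a - b) ⬝ᵥ (a - b) = a ⬝ᵥ a - 2 * (a ⬝ᵥ b) + b ⬝ᵥ b := by
  rw [sub_dotProduct, dotProduct_sub, dotProduct_sub, dotProduct_comm b a]; ring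

end Norm

/-! ### Deterministic error of ridge regression -/

section Ridge

variable {ι κ : Type*} [Fintype ι] [DecidableEq ι] [Fintype κ]

/-- The regularized Gram matrix `Zᵀ Z + lam I`. -/
noncomputable def ridgeGram (lam : ℝ) (Z : Matrix κ ι ℝ) : Matrix ι ι ℝ := Zᵀ * Z + lam • 1

lemma ridgeGram_posDef {lam : ℝ} (hlam : 0 < lam) (Z : Matrix κ ι ℝ) :
    (ridgeGram lam Z).PosDef := by
  refine Matrix.PosDef.posSemidef_add ?_ (Matrix.PosDef.one.smul hlam)
  simpa using Matrix.posSemidef_conjTranspose_mul_self Z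

lemma dotProduct_ridgeGram_mulVec (lam : ℝ) (Z : Matrix κ ι ℝ) (a : ι → ℝ) :
    a ⬝ᵥ ridgeGram lam Z *ᵥ a = (Z *ᵥ a) ⬝ᵥ (Z *ᵥ a) + lam * (a ⬝ᵥ a) := by
  rw [ridgeGram, add_mulVec, dotProduct_add, smul_mulVec, one_mulVec, dotProduct_smul,
    ← mulVec_mulVec, dotProduct_mulVec, vecMul_transpose, smul_eq_mul]

section Sqrt

variable {V : Matrix ι ι ℝ} (hV : V.PosDef)
include hV

lemma sqrt_mul_sqrt_of_posDef : CFC.sqrt V * CFC.sqrt V = V :=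
  CFC.sqrt_mul_sqrt_self V hV.posSemidef.nonneg

omit hV in
lemma transpose_sqrt : (CFC.sqrt V)ᵀ = CFC.sqrt V := by
  simpa using (CFC.sqrt_nonneg V).posSemidef.isHermitian.eq

lemma det_sqrt_of_posDef : (CFC.sqrt V).det = √V.det := by
  have h := congrArg Matrix.det (sqrt_mul_sqrt_of_posDef hV)
  rw [det_mul] at h
  rw [← h, Real.sqrt_mul_self (CFC.sqrt_nonneg V).posSemidef.det_nonneg]

lemma det_sqrt_pos_of_posDef : 0 < (CFC.sqrt V).det := by
  rw [det_sqrt_of_posDef hV]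
  exact Real.sqrt_pos.2 hV.det_pos

lemma isUnit_det_sqrt_of_posDef : IsUnit (CFC.sqrt V).det :=
  (det_sqrt_pos_of_posDef hV).ne'.isUnit

lemma sqrt_inv_mulVec_dotProduct (a b : ι → ℝ) :
    (CFC.sqrt V)⁻¹ *ᵥ a ⬝ᵥ (CFC.sqrt V)⁻¹ *ᵥ b = (V⁻¹ *ᵥ a) ⬝ᵥ b := by
  rw [dotProduct_mulVec, ← mulVec_transpose, transpose_nonsing_inv, transpose_sqrt,
    mulVec_mulVec, ← Matrix.mul_inv_rev, sqrt_mul_sqrt_of_posDef hV]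

lemma sqrt_mulVec_dotProduct (a b : ι → ℝ) :
    CFC.sqrt V *ᵥ a ⬝ᵥ CFC.sqrt V *ᵥ b = a ⬝ᵥ V *ᵥ b := by
  rw [← vecMul_transpose, transpose_sqrt, ← dotProduct_mulVec, mulVec_mulVec,
    sqrt_mul_sqrt_of_posDef hV]

lemma sqrt_mulVec_dotProduct_sqrt_inv_mulVec (a b : ι → ℝ) :
    CFC.sqrt V *ᵥ a ⬝ᵥ (CFC.sqrt V)⁻¹ *ᵥ b = a ⬝ᵥ b := by
  rw [← vecMul_transpose, transpose_sqrt, ← dotProduct_mulVec, mulVec_mulVec,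
    Matrix.mul_nonsing_inv _ (isUnit_det_sqrt_of_posDef hV), one_mulVec]

end Sqrt

/-- Holds because `V ≥ lam I`. The factor `lam` is kept because the regularization bias enters the
error as `lam • θ`. -/
lemma mul_euclNorm_sqrt_inv_le {lam : ℝ} (hlam : 0 < lam) (Z : Matrix κ ι ℝ) (a : ι → ℝ) :
    lam * euclNorm ((CFC.sqrt (ridgeGram lam Z))⁻¹ *ᵥ a) ≤ √lam * euclNorm a := by
  have hV := ridgeGram_posDef hlam Z
  set b := (CFC.sqrt (ridgeGram lam Z))⁻¹ *ᵥ a with hb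
  have hab : a = CFC.sqrt (ridgeGram lam Z) *ᵥ b := by
    rw [hb, mulVec_mulVec, Matrix.mul_nonsing_inv _ (isUnit_det_sqrt_of_posDef hV), one_mulVec]
  have h : lam * euclNorm b ^ 2 ≤ euclNorm a ^ 2 := by
    have h0 : 0 ≤ (Z *ᵥ b) ⬝ᵥ (Z *ᵥ b) := by rw [← euclNorm_sq]; positivity
    rw [euclNorm_sq, euclNorm_sq, hab, sqrt_mulVec_dotProduct hV, dotProduct_ridgeGram_mulVec]
    linarith
  refine abs_le_of_sq_le_sq' ?_ (mul_nonneg (Real.sqrt_nonneg _) (euclNorm_nonneg a)) |>.2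
  rw [mul_pow, mul_pow, Real.sq_sqrt hlam.le]
  nlinarith

/-- The prediction error of ridge regression, in terms of the noise `e` and the
regularization bias. -/
lemma abs_ridge_error_dotProduct_le {lam : ℝ} (hlam : 0 < lam) (Z : Matrix κ ι ℝ)
    (θ : ι → ℝ) (e : κ → ℝ) (z : ι → ℝ) :
    |(θ - (ridgeGram lam Z)⁻¹ *ᵥ (Zᵀ *ᵥ (Z *ᵥ θ + e))) ⬝ᵥ z| ≤
      euclNorm ((CFC.sqrt (ridgeGram lam Z))⁻¹ *ᵥ z) *
        (euclNorm ((CFC.sqrt (ridgeGram lam Z))⁻¹ *ᵥ (Zᵀ *ᵥ e)) + √lam * euclNorm θ) := by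
  have hV := ridgeGram_posDef hlam Z
  set V := ridgeGram lam Z with hVdef
  have hdet : IsUnit V.det := hV.det_pos.ne'.isUnit
  -- Normal equations: `V θ - Zᵀ Z θ = lam θ`.
  have h1 : θ - V⁻¹ *ᵥ (Zᵀ *ᵥ (Z *ᵥ θ + e)) = V⁻¹ *ᵥ (lam • θ - Zᵀ *ᵥ e) := by
    have h2 : θ = V⁻¹ *ᵥ (V *ᵥ θ) := by
      rw [mulVec_mulVec, Matrix.nonsing_inv_mul _ hdet, one_mulVec]
    conv_lhs => enter [1]; rw [h2]
    rw [← mulVec_sub]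
    congr 1
    rw [hVdef, ridgeGram, add_mulVec, smul_mulVec, one_mulVec, mulVec_add, mulVec_mulVec]
    abel
  rw [h1, ← sqrt_inv_mulVec_dotProduct hV, mulVec_sub, mul_comm]
  refine (abs_dotProduct_le _ _).trans ?_
  gcongr
  · exact euclNorm_nonneg _
  refine (euclNorm_sub_le _ _).trans ?_
  rw [mulVec_smul, euclNorm_smul, abs_of_pos hlam]
  linarith [mul_euclNorm_sqrt_inv_le hlam Z θ]

end Ridge

/-! ### Gaussian integrals over the mixing variable -/

section GaussianIntegral

variable {ι : Type*} [Fintype ι] [DecidableEq ι]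

omit [DecidableEq ι] in
-- The Gaussian constant cancels in the mixture argument, so being finite and nonzero is all that
-- matters; its value is never computed.
lemma lintegral_exp_neg_dotProduct_ne_top :
    ∫⁻ y : ι → ℝ, ENNReal.ofReal (Real.exp (-(y ⬝ᵥ y) / 2)) ≠ ⊤ := by
  have h : Integrable (fun y : ι → ℝ => ∏ i, Real.exp (-(1 / 2) * y i ^ 2)) :=
    Integrable.fintype_prod fun _ => integrable_exp_neg_mul_sq (by norm_num)
  have h' : Integrable (fun y : ι → ℝ => Real.exp (-(y ⬝ᵥ y) / 2)) := by
    refine h.congr (ae_of_all _ fun y => ?_)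
    simp only [← Real.exp_sum, dotProduct, ← Finset.mul_sum]
    congr 1
    simp only [← sq]
    ring
  exact h'.lintegral_lt_top.ne

omit [DecidableEq ι] in
lemma lintegral_exp_neg_dotProduct_ne_zero :
    ∫⁻ y : ι → ℝ, ENNReal.ofReal (Real.exp (-(y ⬝ᵥ y) / 2)) ≠ 0 := by
  have hm : Measurable fun y : ι → ℝ => ENNReal.ofReal (Real.exp (-(y ⬝ᵥ y) / 2)) := by
    unfold dotProduct; fun_prop
  rw [Ne, lintegral_eq_zero_iff hm]
  intro h
  obtain ⟨y, hy⟩ := h.exists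
  exact (ENNReal.ofReal_pos.2 (Real.exp_pos _)).ne' hy

/-- Substitution `y = M a`, then translation invariance removes `b`. -/
lemma lintegral_exp_neg_sub_mulVec {M : Matrix ι ι ℝ} (hM : M.det ≠ 0) (b : ι → ℝ) :
    ∫⁻ a : ι → ℝ, ENNReal.ofReal (Real.exp (-((M *ᵥ a - b) ⬝ᵥ (M *ᵥ a - b)) / 2)) =
      ENNReal.ofReal |M.det|⁻¹ *
        ∫⁻ y : ι → ℝ, ENNReal.ofReal (Real.exp (-(y ⬝ᵥ y) / 2)) := by
  have hm : Measurable fun y : ι → ℝ => ENNReal.ofReal (Real.exp (-(y ⬝ᵥ y) / 2)) := by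
    unfold dotProduct; fun_prop
  have hm' : Measurable fun y : ι → ℝ =>
      ENNReal.ofReal (Real.exp (-((y - b) ⬝ᵥ (y - b)) / 2)) := hm.comp (measurable_sub_const b)
  have h := lintegral_map (μ := (volume : Measure (ι → ℝ))) hm'
    (Matrix.toLin' M).continuous_of_finiteDimensional.measurable
  rw [Real.map_matrix_volume_pi_eq_smul_volume_pi hM, lintegral_smul_measure,
    lintegral_sub_right_eq_self (fun y : ι → ℝ => ENNReal.ofReal (Real.exp (-(y ⬝ᵥ y) / 2))) b] at h
  simpa [abs_inv] using h.symm

/-- Completing the square. -/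
lemma lintegral_exp_dotProduct_sub_quadratic {V : Matrix ι ι ℝ} (hV : V.PosDef) {r : ℝ}
    (hr : 0 < r) (S : ι → ℝ) :
    ∫⁻ a : ι → ℝ, ENNReal.ofReal (Real.exp (a ⬝ᵥ S - r * (a ⬝ᵥ V *ᵥ a) / 2)) =
      ENNReal.ofReal (Real.exp (euclNorm ((CFC.sqrt V)⁻¹ *ᵥ S) ^ 2 / (2 * r))) *
        (ENNReal.ofReal (√r ^ Fintype.card ι * √V.det)⁻¹ *
          ∫⁻ y : ι → ℝ, ENNReal.ofReal (Real.exp (-(y ⬝ᵥ y) / 2))) := by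
  have hsr : 0 < √r := Real.sqrt_pos.2 hr
  have hdet : (√r • CFC.sqrt V).det = √r ^ Fintype.card ι * √V.det := by
    rw [det_smul, det_sqrt_of_posDef hV]
  have hpos : 0 < (√r • CFC.sqrt V).det := by
    rw [hdet]
    have := Real.sqrt_pos.2 hV.det_pos
    positivity
  -- The square is that of `M a - b` with `M = √r V^{1/2}` and `b = r^{-1/2} V^{-1/2} S`.
  rw [← hdet, ← abs_of_pos hpos, ← abs_inv, abs_inv,
    ← lintegral_exp_neg_sub_mulVec hpos.ne' ((√r)⁻¹ • (CFC.sqrt V)⁻¹ *ᵥ S),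
    ← lintegral_const_mul' _ _ ENNReal.ofReal_ne_top]
  refine lintegral_congr fun a => ?_
  rw [← ENNReal.ofReal_mul (Real.exp_nonneg _), ← Real.exp_add]
  congr 2
  rw [dotProduct_sub_self, smul_mulVec, smul_dotProduct, dotProduct_smul, smul_dotProduct,
    dotProduct_smul, smul_dotProduct, dotProduct_smul, sqrt_mulVec_dotProduct hV,
    sqrt_mulVec_dotProduct_sqrt_inv_mulVec hV, ← euclNorm_sq]
  simp only [smul_eq_mul]
  have h1 : √r * (√r * (a ⬝ᵥ V *ᵥ a)) = r * (a ⬝ᵥ V *ᵥ a) := by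
    rw [← mul_assoc, Real.mul_self_sqrt hr.le]
  have h2 : √r * ((√r)⁻¹ * (a ⬝ᵥ S)) = a ⬝ᵥ S := mul_inv_cancel_left₀ hsr.ne' _
  have h3 (c : ℝ) : (√r)⁻¹ * ((√r)⁻¹ * c) = c / r := by
    rw [← mul_assoc, ← mul_inv, Real.mul_self_sqrt hr.le]; field_simp
  rw [h1, h2, h3]
  field_simp
  ring

/-- Total mass of the unnormalized mixing weight: the case `V = lam I`, `S = 0` of the previous
formula. -/
lemma lintegral_exp_neg_mul_dotProduct {r lam : ℝ} (hr : 0 < r) (hlam : 0 < lam) :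
    ∫⁻ a : ι → ℝ, ENNReal.ofReal (Real.exp (-(r * lam * (a ⬝ᵥ a)) / 2)) =
      ENNReal.ofReal (√r ^ Fintype.card ι * √lam ^ Fintype.card ι)⁻¹ *
        ∫⁻ y : ι → ℝ, ENNReal.ofReal (Real.exp (-(y ⬝ᵥ y) / 2)) := by
  have hpd : (lam • (1 : Matrix ι ι ℝ)).PosDef := Matrix.PosDef.one.smul hlam
  have hdet : √(lam • (1 : Matrix ι ι ℝ)).det = √lam ^ Fintype.card ι := by
    rw [det_smul, det_one, mul_one]
    rw [Real.sqrt_eq_iff_mul_self_eq (by positivity) (by positivity), ← mul_pow,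
      Real.mul_self_sqrt hlam.le]
  have h := lintegral_exp_dotProduct_sub_quadratic hpd hr (0 : ι → ℝ)
  rw [hdet] at h
  have h0 : euclNorm (0 : ι → ℝ) = 0 := by simp [euclNorm]
  simp only [dotProduct_zero, mulVec_zero, h0, smul_mulVec, one_mulVec, dotProduct_smul,
    smul_eq_mul, zero_sub] at h
  simpa [mul_assoc, neg_div] using h

end GaussianIntegral

/-! ### Self-normalized tail bound by mixtures -/

section SelfNormalized

variable {Ω : Type*} {mΩ : MeasurableSpace Ω} {P : Measure Ω} [IsProbabilityMeasure P]

/-- One supermartingale step. By independence the joint law is a product, so `y` can be integrated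
with `(M, a)` frozen; the bound `hsub` at `c = a ω` cancels the compensator exactly. -/
lemma lintegral_exp_add_le {r : ℝ} {M a y : Ω → ℝ} (hM : Measurable M) (ha : Measurable a)
    (hy : Measurable y) (hind : IndepFun (fun ω => (M ω, a ω)) y P)
    (hsub : ∀ c, ∫⁻ ω, ENNReal.ofReal (Real.exp (c * y ω)) ∂P ≤
      ENNReal.ofReal (Real.exp (r * c ^ 2 / 2))) :
    ∫⁻ ω, ENNReal.ofReal (Real.exp (M ω + (a ω * y ω - r * a ω ^ 2 / 2))) ∂P ≤
      ∫⁻ ω, ENNReal.ofReal (Real.exp (M ω)) ∂P := by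
  have hX : Measurable fun ω => (M ω, a ω) := hM.prodMk ha
  have hprod := (indepFun_iff_map_prod_eq_prod_map_map hX.aemeasurable hy.aemeasurable).1 hind
  set f : (ℝ × ℝ) × ℝ → ENNReal := fun q =>
    ENNReal.ofReal (Real.exp (q.1.1 + (q.1.2 * q.2 - r * q.1.2 ^ 2 / 2))) with hf
  have hfm : Measurable f := by fun_prop
  have h1 : ∫⁻ ω, ENNReal.ofReal (Real.exp (M ω + (a ω * y ω - r * a ω ^ 2 / 2))) ∂P =
      ∫⁻ q, f q ∂(P.map fun ω => ((M ω, a ω), y ω)) := by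
    rw [lintegral_map hfm (hX.prodMk hy)]
  have := Measure.isProbabilityMeasure_map (μ := P) hy.aemeasurable
  rw [h1, hprod, lintegral_prod _ hfm.aemeasurable,
    lintegral_map hfm.lintegral_prod_right' hX]
  refine lintegral_mono fun ω => ?_
  have h2 : Measurable fun v : ℝ => f ((M ω, a ω), v) := by fun_prop
  rw [lintegral_map h2 hy]
  have h3 (ω' : Ω) : f ((M ω, a ω), y ω') =
      ENNReal.ofReal (Real.exp (M ω - r * a ω ^ 2 / 2)) *
        ENNReal.ofReal (Real.exp (a ω * y ω')) := by
    rw [← ENNReal.ofReal_mul (Real.exp_nonneg _), ← Real.exp_add, hf]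
    refine congrArg (fun c => ENNReal.ofReal (Real.exp c)) ?_
    simp only
    ring
  simp_rw [h3]
  rw [lintegral_const_mul' _ _ ENNReal.ofReal_ne_top]
  refine (mul_le_mul_right (hsub (a ω)) _).trans_eq ?_
  rw [← ENNReal.ofReal_mul (Real.exp_nonneg _), ← Real.exp_add]
  congr 2
  ring

/-- The exponential supermartingale of a conditionally sub-Gaussian noise sequence. -/
lemma lintegral_exp_sum_le_one {ℱ : Filtration ℕ mΩ} {r : ℝ} {a y : ℕ → Ω → ℝ}
    (ha : ∀ t, Measurable[ℱ t] (a t)) (hy : ∀ t, Measurable[ℱ (t + 1)] (y t))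
    (hind : ∀ t, Indep (MeasurableSpace.comap (y t) inferInstance) (ℱ t) P)
    (hsub : ∀ t c, ∫⁻ ω, ENNReal.ofReal (Real.exp (c * y t ω)) ∂P ≤
      ENNReal.ofReal (Real.exp (r * c ^ 2 / 2))) (k : ℕ) :
    ∫⁻ ω, ENNReal.ofReal
      (Real.exp (∑ t ∈ Finset.range k, (a t ω * y t ω - r * a t ω ^ 2 / 2))) ∂P ≤ 1 := by
  induction k with
  | zero => simp
  | succ k ih =>
    have hM : Measurable[ℱ k]
        (fun ω => ∑ t ∈ Finset.range k, (a t ω * y t ω - r * a t ω ^ 2 / 2)) := by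
      refine Finset.measurable_fun_sum _ fun t ht => ?_
      have h1 : Measurable[ℱ k] (a t) :=
        (ha t).mono (ℱ.mono (Finset.mem_range.1 ht).le) le_rfl
      have h2 : Measurable[ℱ k] (y t) := (hy t).mono (ℱ.mono (Finset.mem_range.1 ht)) le_rfl
      exact (h1.mul h2).sub (((h1.pow_const 2).const_mul r).div_const 2)
    simp_rw [Finset.sum_range_succ]
    refine (lintegral_exp_add_le (hM.mono (ℱ.le k) le_rfl) ((ha k).mono (ℱ.le k) le_rfl)
      ((hy k).mono (ℱ.le _) le_rfl) ?_ (hsub k)).trans ih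
    have hX := hM.prodMk (ha k)
    exact (indep_of_indep_of_le_right (hind k) hX.comap_le).symm

variable {ι : Type*} [Fintype ι] [DecidableEq ι]

/-- Splits the exponent into the supermartingale part and the Gaussian mixing weight, the latter
coming from the `lam I` in `V`. -/
lemma dotProduct_transpose_mulVec_sub (r lam : ℝ) {k : ℕ} (z : ℕ → ι → ℝ)
    (y : ℕ → ℝ) (a : ι → ℝ) :
    a ⬝ᵥ ((Matrix.of fun t : Fin k => z t)ᵀ *ᵥ fun t => y t) -
        r * (a ⬝ᵥ ridgeGram lam (Matrix.of fun t : Fin k => z t) *ᵥ a) / 2 =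
      ∑ t ∈ Finset.range k, ((z t ⬝ᵥ a) * y t - r * (z t ⬝ᵥ a) ^ 2 / 2) +
        -(r * lam * (a ⬝ᵥ a)) / 2 := by
  rw [dotProduct_ridgeGram_mulVec, dotProduct_mulVec, vecMul_transpose, Finset.sum_sub_distrib,
    ← Finset.sum_div, ← Finset.mul_sum, Finset.sum_range, Finset.sum_range]
  have h1 : ((Matrix.of fun t : Fin k => z t) *ᵥ a) ⬝ᵥ ((Matrix.of fun t : Fin k => z t) *ᵥ a) =
      ∑ t : Fin k, (z t ⬝ᵥ a) ^ 2 := Finset.sum_congr rfl fun t _ => (sq _).symm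
  have h2 : (((Matrix.of fun t : Fin k => z t) *ᵥ a) ⬝ᵥ fun t : Fin k => y t) =
      ∑ t : Fin k, (z t ⬝ᵥ a) * y t := rfl
  rw [h1, h2]
  ring

/-- Self-normalized tail bound by the method of mixtures, at a fixed time `k`. -/
lemma measure_selfNormalized_le {ℱ : Filtration ℕ mΩ} {r lam η : ℝ} (hr : 0 < r)
    (hlam : 0 < lam) (hη : 0 < η) {z : ℕ → Ω → ι → ℝ} {y : ℕ → Ω → ℝ}
    (hz : ∀ t, Measurable[ℱ t] (z t)) (hy : ∀ t, Measurable[ℱ (t + 1)] (y t))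
    (hind : ∀ t, Indep (MeasurableSpace.comap (y t) inferInstance) (ℱ t) P)
    (hsub : ∀ t c, ∫⁻ ω, ENNReal.ofReal (Real.exp (c * y t ω)) ∂P ≤
      ENNReal.ofReal (Real.exp (r * c ^ 2 / 2))) (k : ℕ) :
    P {ω | √r * √(2 * Real.log (√(ridgeGram lam (Matrix.of fun t : Fin k => z t ω)).det /
        (√lam ^ Fintype.card ι * η))) <
      euclNorm ((CFC.sqrt (ridgeGram lam (Matrix.of fun t : Fin k => z t ω)))⁻¹ *ᵥ
        ((Matrix.of fun t : Fin k => z t ω)ᵀ *ᵥ fun t => y t ω))} ≤ ENNReal.ofReal η := by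
  have hzm (t : ℕ) : Measurable (z t) := (hz t).mono (ℱ.le t) le_rfl
  have hym (t : ℕ) : Measurable (y t) := (hy t).mono (ℱ.le _) le_rfl
  set C := ∫⁻ v : ι → ℝ, ENNReal.ofReal (Real.exp (-(v ⬝ᵥ v) / 2)) with hC
  have hC0 : C ≠ 0 := lintegral_exp_neg_dotProduct_ne_zero
  have hCt : C ≠ ⊤ := lintegral_exp_neg_dotProduct_ne_top
  set D : ℝ := (√r ^ Fintype.card ι * √lam ^ Fintype.card ι)⁻¹ with hD
  have hDpos : 0 < D := by
    have := Real.sqrt_pos.2 hr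
    have := Real.sqrt_pos.2 hlam
    positivity
  set F : Ω → (ι → ℝ) → ENNReal := fun ω a => ENNReal.ofReal (Real.exp
    (∑ t ∈ Finset.range k, ((z t ω ⬝ᵥ a) * y t ω - r * (z t ω ⬝ᵥ a) ^ 2 / 2) +
        -(r * lam * (a ⬝ᵥ a)) / 2)) with hF
  have hFm : Measurable (Function.uncurry F) := by
    simp only [hF, Function.uncurry_def, dotProduct]
    have h1 (t : ℕ) (j : ι) : Measurable fun q : Ω × (ι → ℝ) => z t q.1 j :=
      (measurable_pi_apply j).comp ((hzm t).comp measurable_fst)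
    have h2 (t : ℕ) : Measurable fun q : Ω × (ι → ℝ) => y t q.1 := (hym t).comp measurable_fst
    fun_prop
  -- Tonelli: for each fixed `a` the expectation is at most the mixing weight.
  have hint : ∫⁻ ω, (∫⁻ a, F ω a) ∂P ≤ ENNReal.ofReal D * C := by
    rw [lintegral_lintegral_swap hFm.aemeasurable, hC, hD,
      ← lintegral_exp_neg_mul_dotProduct hr hlam]
    refine lintegral_mono fun a => ?_
    simp_rw [hF, Real.exp_add, ENNReal.ofReal_mul (Real.exp_nonneg _)]
    rw [lintegral_mul_const' _ _ ENNReal.ofReal_ne_top]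
    refine mul_le_of_le_one_left zero_le ?_
    refine lintegral_exp_sum_le_one (ℱ := ℱ) (a := fun t ω => z t ω ⬝ᵥ a) (fun t => ?_) hy hind
      hsub k
    refine Finset.measurable_fun_sum _ fun j _ => ?_
    exact ((measurable_pi_apply j).comp (hz t)).mul_const _
  have hle : {ω | √r * √(2 * Real.log (√(ridgeGram lam (Matrix.of fun t : Fin k => z t ω)).det /
        (√lam ^ Fintype.card ι * η))) <
      euclNorm ((CFC.sqrt (ridgeGram lam (Matrix.of fun t : Fin k => z t ω)))⁻¹ *ᵥ
        ((Matrix.of fun t : Fin k => z t ω)ᵀ *ᵥ fun t => y t ω))} ⊆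
      {ω | ENNReal.ofReal (D / η) * C ≤ ∫⁻ a, F ω a} := by
    intro ω hω
    rw [Set.mem_ofPred_eq] at hω ⊢
    simp_rw [hF, ← dotProduct_transpose_mulVec_sub r lam (fun t => z t ω) (fun t => y t ω)]
    set V := ridgeGram lam (Matrix.of fun t : Fin k => z t ω)
    have hV : V.PosDef := ridgeGram_posDef hlam _
    rw [lintegral_exp_dotProduct_sub_quadratic hV hr, ← mul_assoc,
      ← ENNReal.ofReal_mul (Real.exp_nonneg _)]
    set Q := euclNorm ((CFC.sqrt V)⁻¹ *ᵥ
        ((Matrix.of fun t : Fin k => z t ω)ᵀ *ᵥ fun t : Fin k => y t ω))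
    refine mul_le_mul_left (ENNReal.ofReal_le_ofReal ?_) _
    have hs := Real.sqrt_pos.2 hr
    have hl := Real.sqrt_pos.2 hlam
    have hd := Real.sqrt_pos.2 hV.det_pos
    -- As `η` is not bounded above, the logarithm may be negative and its `√` is then zero; the
    -- inequality `c ≤ √c ^ 2` still holds.
    have hQ : Real.log (√V.det / (√lam ^ Fintype.card ι * η)) ≤ Q ^ 2 / (2 * r) := by
      have h1 := pow_le_pow_left₀ (by positivity) hω.le 2
      rw [mul_pow, Real.sq_sqrt hr.le] at h1
      have h2 : 2 * Real.log (√V.det / (√lam ^ Fintype.card ι * η)) ≤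
          √(2 * Real.log (√V.det / (√lam ^ Fintype.card ι * η))) ^ 2 := by
        rw [Real.sq_sqrt']
        exact le_max_left _ _
      rw [le_div_iff₀ (by positivity)]
      nlinarith
    have hE : √V.det / (√lam ^ Fintype.card ι * η) ≤ Real.exp (Q ^ 2 / (2 * r)) :=
      (Real.log_le_iff_le_exp (by positivity)).1 hQ
    -- The random determinant cancels, leaving a deterministic level for Markov's inequality.
    calc D / η = √V.det / (√lam ^ Fintype.card ι * η) * (√r ^ Fintype.card ι * √V.det)⁻¹ := by
          rw [hD]; field_simp
      _ ≤ _ := by gcongr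
  have hmark : ENNReal.ofReal (D / η) * C * P {ω | ENNReal.ofReal (D / η) * C ≤ ∫⁻ a, F ω a} ≤
      ENNReal.ofReal D * C :=
    (mul_meas_ge_le_lintegral hFm.lintegral_prod_right' _).trans hint
  refine (measure_mono hle).trans ?_
  have h0 : ENNReal.ofReal (D / η) * C ≠ 0 :=
    mul_ne_zero (ENNReal.ofReal_pos.2 (by positivity)).ne' hC0
  have ht : ENNReal.ofReal (D / η) * C ≠ ⊤ := ENNReal.mul_ne_top ENNReal.ofReal_ne_top hCt
  refine (ENNReal.mul_le_mul_iff_right h0 ht).1 (hmark.trans_eq ?_)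
  rw [mul_right_comm, ← ENNReal.ofReal_mul (by positivity), div_mul_cancel₀ _ hη.ne']

end SelfNormalized

/-! ### Coordinates and norm of the Gaussian noise -/

section Gaussian

variable {Ω : Type*} {mΩ : MeasurableSpace Ω} {P : Measure Ω} {ι : Type*} [Fintype ι]
  [DecidableEq ι] {W : Matrix ι ι ℝ} {w : Ω → ι → ℝ}

omit [Fintype ι] in
lemma diag_le_of_posSemidef_smul_one_sub {r : ℝ} (hWr : (r • (1 : Matrix ι ι ℝ) - W).PosSemidef)
    (i : ι) : W i i ≤ r := by
  simpa using hWr.diag_nonneg (i := i)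

lemma hasLaw_eval_of_multivariateGaussian (hW : W.PosSemidef)
    (hw : HasLaw (fun ω => WithLp.toLp 2 (w ω)) (multivariateGaussian 0 W) P) (i : ι) :
    HasLaw (fun ω => w ω i) (gaussianReal 0 (W i i).toNNReal) P := by
  simpa using (measurePreserving_eval_multivariateGaussian (μ := 0) hW (i := i)).fun_comp_hasLaw hw

/-- Each coordinate is a centered Gaussian of variance `W i i ≤ r`, whatever its correlation with
the others. -/
lemma lintegral_exp_mul_eval_le (hW : W.PosSemidef) {r : ℝ}
    (hWr : (r • (1 : Matrix ι ι ℝ) - W).PosSemidef)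
    (hw : HasLaw (fun ω => WithLp.toLp 2 (w ω)) (multivariateGaussian 0 W) P) (i : ι) (c : ℝ) :
    ∫⁻ ω, ENNReal.ofReal (Real.exp (c * w ω i)) ∂P ≤
      ENNReal.ofReal (Real.exp (r * c ^ 2 / 2)) := by
  have hlaw := hasLaw_eval_of_multivariateGaussian hW hw i
  rw [hlaw.lintegral_comp (f := fun v => ENNReal.ofReal (Real.exp (c * v))) (by fun_prop),
    ← ofReal_integral_eq_lintegral_ofReal (integrable_exp_mul_gaussianReal c)
      (ae_of_all _ fun _ => Real.exp_nonneg _)]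
  refine ENNReal.ofReal_le_ofReal ?_
  have h := congrFun (mgf_id_gaussianReal (μ := 0) (v := (W i i).toNNReal)) c
  simp only [mgf, id_eq] at h
  rw [h, Real.coe_toNNReal _ hW.diag_nonneg]
  have := diag_le_of_posSemidef_smul_one_sub hWr i
  gcongr
  nlinarith [sq_nonneg c]

lemma lintegral_sq_eval_le (hW : W.PosSemidef) {r : ℝ}
    (hWr : (r • (1 : Matrix ι ι ℝ) - W).PosSemidef)
    (hw : HasLaw (fun ω => WithLp.toLp 2 (w ω)) (multivariateGaussian 0 W) P) (i : ι) :
    ∫⁻ ω, ENNReal.ofReal (w ω i ^ 2) ∂P ≤ ENNReal.ofReal r := by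
  have hlaw := hasLaw_eval_of_multivariateGaussian hW hw i
  have hv := variance_fun_id_gaussianReal (μ := 0) (v := (W i i).toNNReal)
  rw [variance_of_integral_eq_zero (by fun_prop) (by simp)] at hv
  have hi : Integrable (fun v : ℝ => v ^ 2) (gaussianReal 0 (W i i).toNNReal) :=
    (memLp_id_gaussianReal 2).integrable_sq
  rw [hlaw.lintegral_comp (f := fun v => ENNReal.ofReal (v ^ 2)) (by fun_prop),
    ← ofReal_integral_eq_lintegral_ofReal hi (ae_of_all _ fun _ => sq_nonneg _), hv,
    Real.coe_toNNReal _ hW.diag_nonneg]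
  exact ENNReal.ofReal_le_ofReal (diag_le_of_posSemidef_smul_one_sub hWr i)

/-- Markov's inequality for the squared norm of a Gaussian vector with covariance at most `r I`. -/
lemma measure_lt_dotProduct_self_le (hW : W.PosSemidef) {r δ : ℝ} (hr : 0 < r) (hδ : 0 < δ)
    (hWr : (r • (1 : Matrix ι ι ℝ) - W).PosSemidef) (hwm : Measurable w)
    (hw : HasLaw (fun ω => WithLp.toLp 2 (w ω)) (multivariateGaussian 0 W) P) :
    P {ω | 2 * r * Fintype.card ι / δ < w ω ⬝ᵥ w ω} ≤ ENNReal.ofReal (δ / 2) := by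
  -- Without coordinates both sides of the strict inequality are zero, so the event is empty.
  rcases isEmpty_or_nonempty ι with hι | hι
  · simp
  have hc : (0 : ℝ) < Fintype.card ι := by exact_mod_cast Fintype.card_pos
  have hwi (i : ι) : Measurable fun ω => w ω i := (measurable_pi_apply i).comp hwm
  have hsum (ω : Ω) : ENNReal.ofReal (w ω ⬝ᵥ w ω) = ∑ i, ENNReal.ofReal (w ω i ^ 2) := by
    rw [← ENNReal.ofReal_sum_of_nonneg fun _ _ => sq_nonneg _]
    simp only [dotProduct, sq]
  have hint : ∫⁻ ω, ENNReal.ofReal (w ω ⬝ᵥ w ω) ∂P ≤ ENNReal.ofReal (Fintype.card ι * r) := by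
    simp_rw [hsum]
    rw [lintegral_finsetSum _ fun i _ => ((hwi i).pow_const 2).ennreal_ofReal]
    refine (Finset.sum_le_sum fun i _ => lintegral_sq_eval_le hW hWr hw i).trans_eq ?_
    rw [Finset.sum_const, Finset.card_univ, nsmul_eq_mul, ENNReal.ofReal_mul hc.le,
      ENNReal.ofReal_natCast]
  have hm : Measurable fun ω => ENNReal.ofReal (w ω ⬝ᵥ w ω) := by
    simp_rw [hsum]
    exact Finset.measurable_fun_sum _ fun i _ => ((hwi i).pow_const 2).ennreal_ofReal
  have hpos : 0 < 2 * r * Fintype.card ι / δ := by positivity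
  have hmark := (mul_meas_ge_le_lintegral (μ := P) hm
    (ENNReal.ofReal (2 * r * Fintype.card ι / δ))).trans hint
  refine (measure_mono fun ω hω => ?_).trans <| (ENNReal.mul_le_mul_iff_right
    (ENNReal.ofReal_pos.2 hpos).ne' ENNReal.ofReal_ne_top).1 (hmark.trans_eq ?_)
  · exact ENNReal.ofReal_le_ofReal (le_of_lt hω)
  · rw [← ENNReal.ofReal_mul hpos.le]
    congr 1
    field_simp

end Gaussian

/-! ### From confidence bounds to a safe next state -/

section Safety

variable {n m : ℕ}

lemma gram_eq_ridgeGram (lam : ℝ) (x : ℕ → Fin n → ℝ) (u : ℕ → Fin m → ℝ) (k : ℕ) :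
    gram lam x u k = ridgeGram lam (dataMatrix x u k) := rfl

/-- Boundedness of `U` matters: the `sSup` of a set unbounded above is zero by convention. The image
is bounded since the closure of `U` is compact. -/
lemma euclNorm_le_zeta (lam : ℝ) {U : Set (Fin m → ℝ)} (hU : Bornology.IsBounded U)
    (x : ℕ → Fin n → ℝ) (u : ℕ → Fin m → ℝ) (k : ℕ) {u' : Fin m → ℝ} (hu' : u' ∈ U) :
    euclNorm ((CFC.sqrt (gram lam x u k))⁻¹ *ᵥ Sum.elim (x k) u') ≤ zeta lam U x u k := by
  have hc : Continuous fun u' : Fin m → ℝ =>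
      euclNorm ((CFC.sqrt (gram lam x u k))⁻¹ *ᵥ Sum.elim (x k) u') := by
    have h : Continuous fun u' : Fin m → ℝ => Sum.elim (x k) u' := by
      refine continuous_pi fun j => ?_
      cases j with
      | inl j => exact continuous_const
      | inr j => exact continuous_apply j
    unfold euclNorm
    fun_prop
  exact le_csSup ((hU.isCompact_closure.bddAbove_image hc.continuousOn).mono
    (Set.image_mono subset_closure)) (Set.mem_image_of_mem _ hu')

lemma euclNorm_row_le_frobeniusNorm {ι κ : Type*} [Fintype ι] [Fintype κ] (M : Matrix ι κ ℝ)
    (i : ι) : euclNorm (M i) ≤ frobeniusNorm M := by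
  refine Real.le_sqrt_of_sq_le ?_
  rw [euclNorm_sq, dotProduct]
  simp only [← sq]
  exact Finset.single_le_sum (f := fun i => ∑ j, M i j ^ 2)
    (fun _ _ => Finset.sum_nonneg fun _ _ => sq_nonneg _) (Finset.mem_univ i)

lemma confRadius_eq (r s : ℝ) {lam : ℝ} (hlam : 0 < lam) (x : ℕ → Fin n → ℝ)
    (u : ℕ → Fin m → ℝ) (k : ℕ) (η : ℝ) :
    confRadius r s lam x u k η = √r * √(2 * Real.log (√(gram lam x u k).det /
      (√lam ^ Fintype.card (Fin n ⊕ Fin m) * η))) + √lam * s := by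
  have h : lam ^ (((n + m : ℕ) : ℝ) / 2) = √lam ^ Fintype.card (Fin n ⊕ Fin m) := by
    rw [Real.sqrt_eq_rpow, ← Real.rpow_mul_natCast hlam.le, Fintype.card_sum, Fintype.card_fin,
      Fintype.card_fin, one_div_mul_eq_div]
  rw [confRadius, h]

/-- On the event that the noise at time `k` is small and every row of `[A B]` lies in its
confidence ellipsoid, an admissible input leads to a safe state. -/
lemma safe_of_admissible {A : Matrix (Fin n) (Fin n) ℝ} {B : Matrix (Fin n) (Fin m) ℝ}
    {r s lam δ : ℝ} (hlam : 0 < lam) (hAB : frobeniusNorm (Matrix.fromCols A B) ≤ s)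
    {U : Set (Fin m → ℝ)} (hU : Bornology.IsBounded U) {p : ℕ}
    {H : Matrix (Fin p) (Fin n) ℝ} {h : Fin p → ℝ} {x : ℕ → Fin n → ℝ} {u : ℕ → Fin m → ℝ}
    {w : ℕ → Fin n → ℝ} (hdyn : ∀ t, x (t + 1) = A *ᵥ x t + B *ᵥ u t + w t) {k : ℕ}
    (hadm : Admissible r s lam δ U H h x u k (u k)) (hw : w k ⬝ᵥ w k ≤ 2 * r * n / δ)
    (hconf : ∀ i, euclNorm ((CFC.sqrt (gram lam x u k))⁻¹ *ᵥ
        ((dataMatrix x u k)ᵀ *ᵥ fun t : Fin k => w t i)) + √lam * s ≤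
      confRadius r s lam x u k (δ / (2 * n))) :
    H *ᵥ x (k + 1) ≤ h := by
  obtain ⟨hmem, hall⟩ := hadm
  set ζ := zeta lam U x u k with hζ
  set β := confRadius r s lam x u k (δ / (2 * n)) with hβ
  set z : Fin n ⊕ Fin m → ℝ := Sum.elim (x k) (u k) with hz
  have hrow (i : Fin n) (t : ℕ) :
      Matrix.fromCols A B i ⬝ᵥ Sum.elim (x t) (u t) = (A *ᵥ x t + B *ᵥ u t) i := by
    simp [dotProduct, Fintype.sum_sum_type, mulVec]
  have hhat (i : Fin n) : thetaHat lam x u k i ⬝ᵥ z =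
      (Ahat lam x u k *ᵥ x k + Bhat lam x u k *ᵥ u k) i := by
    simp [dotProduct, Fintype.sum_sum_type, mulVec, Ahat, Bhat, hz]
  have hout (i : Fin n) : outputVec x k i =
      dataMatrix x u k *ᵥ Matrix.fromCols A B i + fun t : Fin k => w t i := by
    funext t
    have h1 : (dataMatrix x u k *ᵥ Matrix.fromCols A B i) t = (A *ᵥ x t + B *ᵥ u t) i := by
      rw [← hrow, dotProduct_comm]; rfl
    rw [Pi.add_apply, h1, outputVec, hdyn]
    rfl
  -- The model error at the applied input, which is the `v` to be fed to the robust constraint.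
  set v : Fin n → ℝ := A *ᵥ x k + B *ᵥ u k - (Ahat lam x u k *ᵥ x k + Bhat lam x u k *ᵥ u k)
    with hv
  have hvi (i : Fin n) : |v i| ≤ ζ * β := by
    have h1 : v i = (Matrix.fromCols A B i - thetaHat lam x u k i) ⬝ᵥ z := by
      rw [sub_dotProduct, hhat, hrow]; rfl
    rw [h1, thetaHat, hout, gram_eq_ridgeGram]
    refine (abs_ridge_error_dotProduct_le hlam _ _ _ _).trans ?_
    refine mul_le_mul (euclNorm_le_zeta lam hU x u k hmem) (le_trans ?_ (hconf i))
      (add_nonneg (euclNorm_nonneg _) (mul_nonneg (Real.sqrt_nonneg _) (euclNorm_nonneg _)))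
      ((euclNorm_nonneg _).trans (euclNorm_le_zeta lam hU x u k hmem))
    rw [gram_eq_ridgeGram]
    gcongr
    exact (euclNorm_row_le_frobeniusNorm _ i).trans hAB
  have hvv : v ⬝ᵥ v ≤ ζ ^ 2 * (n : ℝ) ^ 2 * β ^ 2 := by
    have h1 : v ⬝ᵥ v ≤ ∑ _i : Fin n, (ζ * β) ^ 2 := by
      refine Finset.sum_le_sum fun i _ => ?_
      rw [← sq]
      exact sq_le_sq' (abs_le.1 (hvi i)).1 (abs_le.1 (hvi i)).2
    refine h1.trans ?_
    rw [Finset.sum_const, Finset.card_univ, Fintype.card_fin, nsmul_eq_mul]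
    -- Summing the coordinates gives only a factor `n`; the filter allows `n ^ 2`.
    have h2 : (n : ℝ) ≤ (n : ℝ) ^ 2 := by
      exact_mod_cast Nat.le_self_pow (by norm_num) n
    nlinarith [mul_le_mul_of_nonneg_right h2 (sq_nonneg (ζ * β))]
  have hx : x (k + 1) = Ahat lam x u k *ᵥ x k + Bhat lam x u k *ᵥ u k + v + w k := by
    rw [hdyn, hv]; abel
  rw [hx]
  exact hall _ hw v hvv

end Safety

end SafeLearning

/-- Safety of the filtered input. The noise `w[t]` is Gaussian with mean zero and covariance `W`,
and independent of the past `ℱ t`, which contains `x[0]`, `w[0], …, w[t-1]`, `u[0], …, u[t]`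
(so the `w[t]` are independent and identically distributed and the inputs are causal). -/
theorem theorem2 {Ω : Type*} [mΩ : MeasurableSpace Ω] (P : Measure Ω) [IsProbabilityMeasure P]
    {n m : ℕ}
    -- parameters of the system and of the filter
    (A : Matrix (Fin n) (Fin n) ℝ) (B : Matrix (Fin n) (Fin m) ℝ) (W : Matrix (Fin n) (Fin n) ℝ)
    (r s lam δ : ℝ) (hr : 0 < r) (hs : 0 < s) (hlam : 0 < lam) (hδ : 0 < δ) (hδ1 : δ ≤ 1)
    (hW : W.PosSemidef) (hWr : (r • (1 : Matrix (Fin n) (Fin n) ℝ) - W).PosSemidef)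
    (hAB : SafeLearning.frobeniusNorm (Matrix.fromCols A B) ≤ s)
    -- input set, safety constraints, distance and nominal input
    (U : Set (Fin m → ℝ)) (hU : Bornology.IsBounded U)
    (p : ℕ → ℕ) (H : ∀ t, Matrix (Fin (p t)) (Fin n) ℝ) (h : ∀ t, Fin (p t) → ℝ)
    (d : (Fin m → ℝ) → (Fin m → ℝ) → ℝ) (ubar : ℕ → Ω → Fin m → ℝ)
    -- the closed-loop process
    (ℱ : Filtration ℕ mΩ)
    (x : ℕ → Ω → Fin n → ℝ) (u : ℕ → Ω → Fin m → ℝ) (w : ℕ → Ω → Fin n → ℝ)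
    (hx0 : Measurable[ℱ 0] (x 0))
    (hu : ∀ t, Measurable[ℱ t] (u t))
    (hw : ∀ t, Measurable[ℱ (t + 1)] (w t))
    (hw_law : ∀ t, HasLaw (fun ω => WithLp.toLp 2 (w t ω)) (multivariateGaussian 0 W) P)
    (hw_indep : ∀ t, Indep (MeasurableSpace.comap (w t) inferInstance) (ℱ t) P)
    (hdyn : ∀ t ω, x (t + 1) ω = A *ᵥ x t ω + B *ᵥ u t ω + w t ω)
    -- at time `k`, the solution of the filter problem is applied whenever the problem is feasible
    (k : ℕ)
    (husol : ∀ᵐ ω ∂P,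
      SafeLearning.Feasible r s lam δ U (H (k + 1)) (h (k + 1)) (x · ω) (u · ω) k →
      SafeLearning.IsSolution r s lam δ U (H (k + 1)) (h (k + 1)) d (ubar k ω)
        (x · ω) (u · ω) k (u k ω)) :
    -- feasible, but unsafe at time `k + 1`: probability at most `δ`
    P {ω | SafeLearning.Feasible r s lam δ U (H (k + 1)) (h (k + 1)) (x · ω) (u · ω) k ∧
        ¬ H (k + 1) *ᵥ x (k + 1) ω ≤ h (k + 1)} ≤ ENNReal.ofReal δ ∧
    -- so if the problem is feasible almost surely, then the next state is safe
    ((∀ᵐ ω ∂P, SafeLearning.Feasible r s lam δ U (H (k + 1)) (h (k + 1)) (x · ω) (u · ω) k) →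
      1 - δ ≤ P.real {ω | H (k + 1) *ᵥ x (k + 1) ω ≤ h (k + 1)}) := by
  have hwm (t : ℕ) : Measurable (w t) := (hw t).mono (ℱ.le _) le_rfl
  have hx (t : ℕ) : Measurable[ℱ t] (x t) := by
    induction t with
    | zero => exact hx0
    | succ t ih =>
      have h1 : Measurable[ℱ (t + 1)] (x t) := ih.mono (ℱ.mono t.le_succ) le_rfl
      have h2 : Measurable[ℱ (t + 1)] (u t) := (hu t).mono (ℱ.mono t.le_succ) le_rfl
      have hA : Measurable fun a : Fin n → ℝ => A *ᵥ a := by fun_prop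
      have hB : Measurable fun b : Fin m → ℝ => B *ᵥ b := by fun_prop
      rw [show x (t + 1) = fun ω => A *ᵥ x t ω + B *ᵥ u t ω + w t ω from funext (hdyn t)]
      exact ((hA.comp h1).add (hB.comp h2)).add (hw t)
  have hz (t : ℕ) : Measurable[ℱ t] fun ω => (Sum.elim (x t ω) (u t ω) : Fin n ⊕ Fin m → ℝ) := by
    refine @measurable_pi_lambda _ _ _ (ℱ t) _ _ fun j => ?_
    cases j with
    | inl j => exact (measurable_pi_apply j).comp (hx t)
    | inr j => exact (measurable_pi_apply j).comp (hu t)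
  set noiseBad : Set Ω := {ω | 2 * r * n / δ < w k ω ⬝ᵥ w k ω} with hnoise
  set confBad : Fin n → Set Ω := fun i => {ω | √r * √(2 * Real.log
      (√(SafeLearning.gram lam (x · ω) (u · ω) k).det /
        (√lam ^ Fintype.card (Fin n ⊕ Fin m) * (δ / (2 * n))))) <
    SafeLearning.euclNorm ((CFC.sqrt (SafeLearning.gram lam (x · ω) (u · ω) k))⁻¹ *ᵥ
      ((SafeLearning.dataMatrix (x · ω) (u · ω) k)ᵀ *ᵥ fun t : Fin k => w t ω i))} with hconf
  have hnoiseP : P noiseBad ≤ ENNReal.ofReal (δ / 2) := by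
    simpa using SafeLearning.measure_lt_dotProduct_self_le hW hr hδ hWr (hwm k) (hw_law k)
  have hconfP (i : Fin n) : P (confBad i) ≤ ENNReal.ofReal (δ / (2 * n)) := by
    have hn : (0 : ℝ) < n := by exact_mod_cast i.pos
    refine SafeLearning.measure_selfNormalized_le (ℱ := ℱ) hr hlam (by positivity) hz
      (y := fun t ω => w t ω i) (fun t => (measurable_pi_apply i).comp (hw t)) (fun t => ?_)
      (fun t c => SafeLearning.lintegral_exp_mul_eval_le hW hWr (hw_law t) i c) k
    refine indep_of_indep_of_le_left (hw_indep t) ?_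
    exact ((measurable_pi_apply i).comp (comap_measurable (w t))).comap_le
  have hunionP : P (⋃ i, confBad i) ≤ ENNReal.ofReal (δ / 2) := by
    refine (measure_iUnion_fintype_le P confBad).trans
      ((Finset.sum_le_sum fun i _ => hconfP i).trans ?_)
    rw [Finset.sum_const, Finset.card_univ, Fintype.card_fin, nsmul_eq_mul,
      ← ENNReal.ofReal_natCast, ← ENNReal.ofReal_mul (Nat.cast_nonneg n)]
    refine ENNReal.ofReal_le_ofReal ?_
    -- For `n = 0` the union is over no rows; otherwise `n` times `δ / (2 n)` is exactly `δ / 2`.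
    rcases Nat.eq_zero_or_pos n with hn | hn
    · subst hn
      simpa using (half_pos hδ).le
    · have : (0 : ℝ) < n := by exact_mod_cast hn
      exact le_of_eq (by field_simp)
  have hmain : P {ω | SafeLearning.Feasible r s lam δ U (H (k + 1)) (h (k + 1)) (x · ω) (u · ω) k ∧
      ¬ H (k + 1) *ᵥ x (k + 1) ω ≤ h (k + 1)} ≤ ENNReal.ofReal δ := by
    -- An inclusion up to a null set suffices: monotonicity of `P` needs no measurability of the
    -- feasibility event.
    have hsub : {ω | SafeLearning.Feasible r s lam δ U (H (k + 1)) (h (k + 1)) (x · ω) (u · ω) k ∧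
        ¬ H (k + 1) *ᵥ x (k + 1) ω ≤ h (k + 1)} ≤ᵐ[P]
        (noiseBad ∪ ⋃ i, confBad i : Set Ω) := by
      filter_upwards [husol] with ω hsol
      rintro ⟨hfeas, hviol⟩
      by_contra hgood
      replace hgood : ¬ (ω ∈ noiseBad ∪ ⋃ i, confBad i) := hgood
      rw [Set.mem_union, Set.mem_iUnion, not_or, not_exists] at hgood
      refine hviol (SafeLearning.safe_of_admissible hlam hAB hU (w := fun t => w t ω)
        (fun t => hdyn t ω) (hsol hfeas).1 (not_lt.1 hgood.1) fun i => ?_)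
      rw [SafeLearning.confRadius_eq r s hlam]
      exact add_le_add_left (not_lt.1 (hgood.2 i)) _
    refine (measure_mono_ae hsub).trans ((measure_union_le _ _).trans
      ((add_le_add hnoiseP hunionP).trans_eq ?_))
    rw [← ENNReal.ofReal_add (by positivity) (by positivity), add_halves]
  refine ⟨hmain, fun hfeas => ?_⟩
  have hviol : P {ω | H (k + 1) *ᵥ x (k + 1) ω ≤ h (k + 1)}ᶜ ≤ ENNReal.ofReal δ := by
    refine (measure_mono_ae ?_).trans hmain
    filter_upwards [hfeas] with ω hω hviol
    exact ⟨hω, hviol⟩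
  -- Subadditivity on a set and its complement avoids proving the safe event measurable.
  have huniv := measureReal_union_le (μ := P) {ω | H (k + 1) *ᵥ x (k + 1) ω ≤ h (k + 1)}
    {ω | H (k + 1) *ᵥ x (k + 1) ω ≤ h (k + 1)}ᶜ
  rw [Set.union_compl_self, probReal_univ] at huniv
  have hle : P.real {ω | H (k + 1) *ᵥ x (k + 1) ω ≤ h (k + 1)}ᶜ ≤ δ :=
    ENNReal.toReal_le_of_le_ofReal hδ.le hviol
  linarith
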